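/- Let $2\le p\le q$ be integers and let $$BS(p,q)=\langle a,t \mid t a^p t^{-1}=a^q\rangle$$ be the Baumslag--Solitar group. For $x\in BS(p,q)$ let $\|x\|$ be the least length of a word in $a^{\pm1},t^{\pm1}$ representing $x$, let $\gamma(n)=\#\{x\in BS(p,q):\|x\|\le n\}$, and let the growth rate of $BS(p,q)$ be $\lim_{n\to\infty}\gamma(n)^{1/n}$ (this limit exists). Put $k=\lfloor p/2\rfloor$, $\ell=\lfloor q/2\rfloor$, and $$C_k=\begin{cases}1&\text{if }p=2k\\2&\text{if }p=2k+1\end{cases}\qquad C_\ell=\begin{cases}1&\text{if }q=2\ell\\2&\text{if }q=2\ell+1.\end{cases}$$ Define the polynomial $P_{pq}$ as follows. If $p\ge4$, $$P_{pq}(x)=x^{\ell+1}-x^{\ell}-2(x^{\ell-1}+x^{\ell-2}+\dots+x^{\ell-k+1})-C_kx^{\ell-k}-2(x^{\ell-1}+x^{\ell-2}+\dots+x)-C_\ell .$$ In the remaining cases $p\in\{2,3\}$, $$\begin{aligned} P_{22}(x)&=x^2-x-2,\\ P_{23}(x)&=x^2-x-3,\\ P_{2q}(x)&=x^{\ell+1}-x^{\ell}-x^{\ell-1}-2(x^{\ell-1}+x^{\ell-2}+\dots+x)-C_\ell\quad(q\ge4),\\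 P_{33}(x)&=x^2-x-4,\\ P_{3q}(x)&=x^{\ell+1}-x^{\ell}-2x^{\ell-1}-2(x^{\ell-1}+x^{\ell-2}+\dots+x)-C_\ell\quad(q\ge4). \end{aligned}$$ Then $P_{pq}$ has a largest real zero, and the growth rate of $BS(p,q)$ is at least this zero. -/

import Mathlib

open Polynomial Filter Topology

noncomputable section

/-- The two generator symbols of a Baumslag--Solitar group. -/
inductive BSGen : Type
  | a
  | t

/-- The Baumslag--Solitar group `BS(p,q) = ⟨a, t ∣ t a^p t⁻¹ = a^q⟩`. -/
abbrev BS (p q : ℕ) : Type :=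
  PresentedGroup
    ({FreeGroup.of BSGen.t * FreeGroup.of BSGen.a ^ p * (FreeGroup.of BSGen.t)⁻¹ *
        (FreeGroup.of BSGen.a ^ q)⁻¹} : Set (FreeGroup BSGen))

/-- The standard generating set `{a, t}` of `BS(p,q)`. -/
def BS.gens (p q : ℕ) : Set (BS p q) :=
  {PresentedGroup.of BSGen.a, PresentedGroup.of BSGen.t}

/-- Word length of `x` with respect to `S`: the least length of a word in `S ∪ S⁻¹` that
represents `x` (and `⊤` if `x` is not in the subgroup generated by `S`). -/
def wordLength {G : Type*} [Group G] (S : Set G) (x : G) : ℕ∞ :=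
  ⨅ (w : List G) (_ : (∀ g ∈ w, g ∈ S ∨ g⁻¹ ∈ S) ∧ w.prod = x), (w.length : ℕ∞)

/-- The growth function `γ(n) = #{x : ‖x‖ ≤ n}`. -/
def growthFunction {G : Type*} [Group G] (S : Set G) (n : ℕ) : ℕ :=
  {x : G | wordLength S x ≤ n}.ncard

/-- The exponential growth rate `limsup γ(n)^(1/n)`. -/
def growthRate {G : Type*} [Group G] (S : Set G) : ℝ :=
  limsup (fun n : ℕ => (growthFunction S n : ℝ) ^ (1 / (n : ℝ))) atTop

/-- The constant attached to `n`: it is `1` if `n` is even and `2` if `n` is odd. -/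
def parityConst (n : ℕ) : ℝ :=
  if Even n then 1 else 2

/-- The polynomial `P_{pq}` (meaningful for `2 ≤ p ≤ q`), with `k = ⌊p/2⌋` and `ℓ = ⌊q/2⌋`. -/
def growthPoly (p q : ℕ) : ℝ[X] :=
  let k := p / 2
  let l := q / 2
  if 4 ≤ p then
    X ^ (l + 1) - X ^ l - 2 * ∑ i ∈ Finset.Icc (l - k + 1) (l - 1), X ^ i
      - C (parityConst p) * X ^ (l - k) - 2 * ∑ i ∈ Finset.Icc 1 (l - 1), X ^ i
      - C (parityConst q)
  else if p = 3 then
    if q = 3 then X ^ 2 - X - 4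
    else
      X ^ (l + 1) - X ^ l - 2 * X ^ (l - 1) - 2 * ∑ i ∈ Finset.Icc 1 (l - 1), X ^ i
        - C (parityConst q)
  else
    if q = 2 then X ^ 2 - X - 2
    else if q = 3 then X ^ 2 - X - 3
    else
      X ^ (l + 1) - X ^ l - X ^ (l - 1) - 2 * ∑ i ∈ Finset.Icc 1 (l - 1), X ^ i
        - C (parityConst q)

end

/-!
By Britton's lemma, the words `t ^ u₁ * a ^ r₁ * ⋯ * t ^ uₙ * a ^ rₙ` with `uᵢ = ±1`, with `rᵢ` a
residue of least absolute value modulo `p` if `uᵢ = 1` and modulo `q` if `uᵢ = -1`, and without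
subwords `t ^ u * a ^ 0 * t ^ (-u)`, represent distinct elements of `BS(p,q)`. A syllable with
`rᵢ = 0` that is not the last one is followed by a syllable of the same sign, so it can be recorded
by a single letter; this identifies a set of normal words with the free monoid on finitely many
letters. The lengths of the letters have generating function
`f(z) = z * (1 + ∑_{r ≢ 0 mod p} z ^ |r| + ∑_{r ≢ 0 mod q} z ^ |r|)`, and where `f(z) = 1` the
generating function `∑ f(z) ^ n` of the free monoid diverges. Hence so does `∑ γ(n) * z ^ n`, and
the growth rate is at least `1 / z`. Finally `P_{pq}(x) = x ^ (ℓ + 1) * (1 - f(1 / x))`, and `f` is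
increasing, so `1 / z` is the only positive zero of `P_{pq}`.
-/

open scoped ENNReal Pointwise

section WordGrowth

variable {G : Type*} [Group G] {S : Set G}

/-- The ball of radius `1` of the word metric of `S`; the balls of radius `n` are its powers. -/
def unitBall (S : Set G) : Set G := insert 1 (S ∪ S⁻¹)

theorem one_mem_unitBall : (1 : G) ∈ unitBall S := Set.mem_insert _ _

theorem wordLength_le_iff_mem_pow {x : G} {n : ℕ} :
    wordLength S x ≤ n ↔ x ∈ unitBall S ^ n := by
  constructor
  · intro h
    have hlt : wordLength S x < (n + 1 : ℕ) := h.trans_lt (by exact_mod_cast n.lt_succ_self)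
    simp only [wordLength, iInf_lt_iff] at hlt
    obtain ⟨w, ⟨hw, rfl⟩, hlen⟩ := hlt
    refine Set.pow_subset_pow_right one_mem_unitBall (Nat.lt_succ_iff.1 (by exact_mod_cast hlen)) ?_
    clear h hlen
    induction w with
    | nil => simp
    | cons g w ih =>
      rw [List.prod_cons, List.length_cons, pow_succ']
      exact Set.mul_mem_mul (.inr (hw g List.mem_cons_self))
        (ih fun h hh => hw h (List.mem_cons_of_mem g hh))
  · suffices x ∈ unitBall S ^ n →
        ∃ w : List G, ((∀ g ∈ w, g ∈ S ∨ g⁻¹ ∈ S) ∧ w.prod = x) ∧ w.length ≤ n from fun hx =>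
      let ⟨w, hw, hlen⟩ := this hx
      (iInf₂_le w hw).trans (by exact_mod_cast hlen)
    induction n generalizing x with
    | zero => exact fun hx => ⟨[], by simpa [eq_comm] using hx⟩
    | succ n ih =>
      rw [pow_succ']
      rintro ⟨g, hg, y, hy, rfl⟩
      obtain ⟨w, ⟨hw, rfl⟩, hlen⟩ := ih hy
      rcases hg with rfl | hg
      · exact ⟨w, ⟨hw, by simp⟩, by omega⟩
      · exact ⟨g :: w, ⟨List.forall_mem_cons.2 ⟨hg, hw⟩, by simp⟩, by simpa using hlen⟩

theorem growthFunction_eq_ncard_pow (n : ℕ) : growthFunction S n = (unitBall S ^ n).ncard :=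
  congrArg Set.ncard (Set.ext fun _ => wordLength_le_iff_mem_pow)

theorem finite_unitBall_pow (hS : S.Finite) (n : ℕ) : (unitBall S ^ n).Finite := by
  induction n with
  | zero => simp
  | succ n ih => exact pow_succ (unitBall S) n ▸ ih.mul ((hS.union hS.inv).insert 1)

theorem growthFunction_pos (hS : S.Finite) (n : ℕ) : 0 < growthFunction S n := by
  rw [growthFunction_eq_ncard_pow]
  exact (Set.ncard_pos (finite_unitBall_pow hS n)).2 ⟨1, Set.one_mem_pow one_mem_unitBall⟩

theorem growthFunction_add_le (m n : ℕ) :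
    growthFunction S (m + n) ≤ growthFunction S m * growthFunction S n := by
  simp only [growthFunction_eq_ncard_pow, pow_add]
  exact Set.natCard_mul_le

theorem tendsto_growthRate (hS : S.Finite) :
    Tendsto (fun n : ℕ => (growthFunction S n : ℝ) ^ (1 / (n : ℝ))) atTop
      (𝓝 (growthRate S)) := by
  have hpos (n) : (0 : ℝ) < growthFunction S n := by exact_mod_cast growthFunction_pos hS n
  have hsub : Subadditive fun n => Real.log (growthFunction S n) := fun m n => by
    rw [← Real.log_mul (hpos m).ne' (hpos n).ne']
    exact Real.log_le_log (hpos _) (by exact_mod_cast growthFunction_add_le m n)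
  have hbdd : BddBelow (Set.range fun n : ℕ => Real.log (growthFunction S n) / n) := ⟨0, by
    rintro _ ⟨n, rfl⟩
    exact div_nonneg (Real.log_natCast_nonneg _) n.cast_nonneg⟩
  have hexp : Real.exp ∘ (fun n : ℕ => Real.log (growthFunction S n) / n) =
      fun n : ℕ => (growthFunction S n : ℝ) ^ (1 / (n : ℝ)) := by
    funext n
    rw [Function.comp_apply, Real.rpow_def_of_pos (hpos n), mul_one_div]
  have hlim := (Real.continuous_exp.tendsto _).comp (hsub.tendsto_lim hbdd)
  rw [hexp] at hlim
  rwa [growthRate, hlim.limsup_eq]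

theorem wordLength_mul_le {x y : G} {m n : ℕ} (hx : wordLength S x ≤ m)
    (hy : wordLength S y ≤ n) : wordLength S (x * y) ≤ (m + n : ℕ) := by
  rw [wordLength_le_iff_mem_pow] at *
  exact pow_add (unitBall S) m n ▸ Set.mul_mem_mul hx hy

theorem wordLength_one_le (n : ℕ) : wordLength S (1 : G) ≤ n :=
  wordLength_le_iff_mem_pow.2 (Set.one_mem_pow one_mem_unitBall)

theorem wordLength_zpow_le {g : G} (hg : g ∈ S) (r : ℤ) : wordLength S (g ^ r) ≤ r.natAbs := by
  rw [wordLength_le_iff_mem_pow]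
  obtain ⟨n, rfl | rfl⟩ := r.eq_nat_or_neg
  · simpa using Set.pow_mem_pow (n := n) (show g ∈ unitBall S from .inr (.inl hg))
  · simpa using Set.pow_mem_pow (n := n)
      (show g⁻¹ ∈ unitBall S from .inr (.inr (Set.inv_mem_inv.2 hg)))

end WordGrowth

section GrowthBound

theorem summable_of_tendsto_rpow_one_div {a : ℕ → ℝ} {c : ℝ} (ha : ∀ n, 0 ≤ a n)
    (hlim : Tendsto (fun n : ℕ => a n ^ (1 / (n : ℝ))) atTop (𝓝 c)) (hc : c < 1) :
    Summable a := by
  have hc0 : 0 ≤ c := ge_of_tendsto' hlim fun n => Real.rpow_nonneg (ha n) _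
  obtain ⟨r, hcr, hr1⟩ := exists_between hc
  refine Summable.of_norm_bounded_eventually_nat
    (summable_geometric_of_lt_one (hc0.trans hcr.le) hr1) ?_
  filter_upwards [hlim.eventually_lt_const hcr, eventually_ne_atTop 0] with n hn hn0
  rw [one_div] at hn
  calc ‖a n‖ = (a n ^ (n⁻¹ : ℝ)) ^ n := by
        rw [Real.rpow_inv_natCast_pow (ha n) hn0, Real.norm_of_nonneg (ha n)]
    _ ≤ r ^ n := pow_le_pow_left₀ (Real.rpow_nonneg (ha n) _) hn.le n

theorem tsum_list_prod {ι : Type*} (w : ι → ℝ≥0∞) :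
    ∑' l : List ι, (l.map w).prod = 1 + (∑' i, w i) * ∑' l : List ι, (l.map w).prod := by
  have hcons : Function.Injective fun x : ι × List ι => x.1 :: x.2 := fun x y h =>
    Prod.ext (List.cons.inj h).1 (List.cons.inj h).2
  have hrange : ({[]}ᶜ : Set (List ι)) = Set.range fun x : ι × List ι => x.1 :: x.2 := by
    ext (_ | ⟨i, l⟩) <;> simp
  calc ∑' l : List ι, (l.map w).prod
      = (([] : List ι).map w).prod + ∑' x : ι × List ι, ((x.1 :: x.2).map w).prod := by
        rw [← ENNReal.summable.tsum_add_tsum_compl (s := {[]}) ENNReal.summable,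
          tsum_singleton [] fun l : List ι => (l.map w).prod, hrange,
          tsum_range (fun l : List ι => (l.map w).prod) hcons]
    _ = 1 + (∑' i, w i) * ∑' l : List ι, (l.map w).prod := by
        simp only [List.map_nil, List.prod_nil, List.map_cons, List.prod_cons,
          ENNReal.tsum_prod (f := fun i l => w i * (List.map w l).prod),
          ENNReal.tsum_mul_left, ENNReal.tsum_mul_right]

theorem tsum_list_prod_eq_top {ι : Type*} {w : ι → ℝ≥0∞} (hw : 1 ≤ ∑' i, w i) :
    ∑' l : List ι, (l.map w).prod = ∞ := by
  by_contra hne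
  have hle : 1 + ∑' l : List ι, (l.map w).prod ≤ ∑' l : List ι, (l.map w).prod := by
    conv_rhs => rw [tsum_list_prod]
    gcongr
    exact le_mul_of_one_le_left' hw
  exact hle.not_gt (add_comm (1 : ℝ≥0∞) _ ▸ ENNReal.lt_add_right hne one_ne_zero)

variable {G : Type*} [Group G] {S : Set G}

theorem summable_growthFunction_mul_pow (hS : S.Finite) {z : ℝ} (hz : 0 ≤ z)
    (h : growthRate S * z < 1) : Summable fun n => growthFunction S n * z ^ n := by
  refine summable_of_tendsto_rpow_one_div (fun n => by positivity)
    (((tendsto_growthRate hS).mul_const z).congr' ?_) h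
  filter_upwards [eventually_ne_atTop 0] with n hn
  rw [Real.mul_rpow (Nat.cast_nonneg _) (by positivity), one_div, Real.pow_rpow_inv_natCast hz hn]

theorem tsum_pow_le_tsum_growthFunction (hS : S.Finite) {α : Type*} {F : α → G}
    (hF : Function.Injective F) {len : α → ℕ} (hlen : ∀ x, wordLength S (F x) ≤ len x)
    (z : ℝ≥0∞) : ∑' x, z ^ len x ≤ ∑' n, growthFunction S n * z ^ n := by
  rw [← ENNReal.tsum_fiberwise _ len]
  refine ENNReal.tsum_le_tsum fun n => ?_
  have hfin : {x : G | wordLength S x ≤ n}.Finite :=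
    (finite_unitBall_pow hS n).subset fun _ => wordLength_le_iff_mem_pow.1
  have hcard : (len ⁻¹' {n}).encard ≤ growthFunction S n := by
    rw [growthFunction, ← hF.encard_image, hfin.cast_ncard_eq]
    refine Set.encard_le_encard ?_
    rintro _ ⟨x, rfl, rfl⟩
    exact hlen x
  calc ∑' x : len ⁻¹' {n}, z ^ len x = ∑' _ : len ⁻¹' {n}, z ^ n :=
        tsum_congr fun x => congrArg (z ^ ·) x.2
    _ = (len ⁻¹' {n}).encard * z ^ n := ENNReal.tsum_const _
    _ ≤ growthFunction S n * z ^ n := by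
        gcongr
        exact_mod_cast ENat.toENNReal_le.2 hcard

theorem inv_le_growthRate_of_injective (hS : S.Finite) {ι : Type*} {len : ι → ℕ}
    {F : List ι → G} (hF : Function.Injective F)
    (hlen : ∀ l, wordLength S (F l) ≤ (l.map len).sum) {z : ℝ} (hz : 0 < z)
    (hsum : HasSum (fun i => z ^ len i) 1) : z⁻¹ ≤ growthRate S := by
  by_contra! hlt
  have hsummable := summable_growthFunction_mul_pow hS hz.le
    (by rwa [← lt_div_iff₀ hz, one_div])
  have hone : ∑' i, ENNReal.ofReal z ^ len i = 1 := by
    simp only [← ENNReal.ofReal_pow hz.le]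
    rw [← ENNReal.ofReal_tsum_of_nonneg (fun i => by positivity) hsum.summable, hsum.tsum_eq,
      ENNReal.ofReal_one]
  have hprod (l : List ι) : (l.map fun i => ENNReal.ofReal z ^ len i).prod =
      ENNReal.ofReal z ^ (l.map len).sum := by
    induction l with
    | nil => simp
    | cons i l ih => simp [ih, pow_add]
  have htop : (∞ : ℝ≥0∞) ≤ ∑' n, ENNReal.ofReal (growthFunction S n * z ^ n) :=
    calc ∞ = ∑' l : List ι, ENNReal.ofReal z ^ (l.map len).sum := by
          simp only [← hprod, tsum_list_prod_eq_top hone.ge]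
      _ ≤ ∑' n, growthFunction S n * ENNReal.ofReal z ^ n :=
          tsum_pow_le_tsum_growthFunction hS hF hlen _
      _ = ∑' n, ENNReal.ofReal (growthFunction S n * z ^ n) := by
          simp only [ENNReal.ofReal_mul (Nat.cast_nonneg _), ENNReal.ofReal_natCast,
            ENNReal.ofReal_pow hz.le]
  exact hsummable.tsum_ofReal_ne_top (top_le_iff.1 htop)

end GrowthBound

section Residues

/-- The residues modulo `m` of least absolute value, with `-m / 2` chosen over `m / 2` when `m` is
even. -/
noncomputable def balancedResidues (m : ℕ) : Finset ℤ :=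
  Finset.Ico (-((m / 2 : ℕ) : ℤ)) (((m + 1) / 2 : ℕ) : ℤ)

theorem mem_balancedResidues_iff {m : ℕ} [NeZero m] {r : ℤ} :
    r ∈ balancedResidues m ↔ r.bmod m = r := by
  rw [Int.bmod_eq_iff (NeZero.pos m), balancedResidues, Finset.mem_Ico]
  simp only [sub_self, dvd_zero, and_true]
  omega

theorem sum_natAbs_balancedResidues_erase_zero {M : Type*} [AddCommMonoid M] (m : ℕ) (f : ℕ → M) :
    ∑ r ∈ (balancedResidues m).erase 0, f r.natAbs =
      ∑ i ∈ Finset.Icc 1 (m / 2), f i + ∑ i ∈ Finset.Icc 1 ((m - 1) / 2), f i := by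
  rw [← Finset.sum_filter_add_sum_filter_not _ (· < 0)]
  congr 1
  · refine Finset.sum_nbij' Int.natAbs (fun i => -(i : ℤ)) ?_ ?_ ?_ ?_ fun _ _ => rfl <;>
      simp only [balancedResidues, Finset.mem_filter, Finset.mem_erase, Finset.mem_Ico,
        Finset.mem_Icc] <;> omega
  · refine Finset.sum_nbij' Int.natAbs (fun i => (i : ℤ)) ?_ ?_ ?_ ?_ fun _ _ => rfl <;>
      simp only [balancedResidues, Finset.mem_filter, Finset.mem_erase, Finset.mem_Ico,
        Finset.mem_Icc] <;> omega

theorem sum_pow_natAbs_balancedResidues_erase_zero {m : ℕ} (hm : 2 ≤ m) (z : ℝ) :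
    ∑ r ∈ (balancedResidues m).erase 0, z ^ r.natAbs =
      2 * ∑ i ∈ Finset.Icc 1 (m / 2 - 1), z ^ i + parityConst m * z ^ (m / 2) := by
  have htop : ∑ i ∈ Finset.Icc 1 (m / 2), z ^ i =
      ∑ i ∈ Finset.Icc 1 (m / 2 - 1), z ^ i + z ^ (m / 2) := by
    obtain ⟨k, hk⟩ : ∃ k, m / 2 = k + 1 := ⟨m / 2 - 1, by omega⟩
    rw [hk, Finset.sum_Icc_succ_top (by omega), Nat.add_sub_cancel]
  rw [sum_natAbs_balancedResidues_erase_zero m (z ^ ·)]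
  obtain ⟨k, rfl | rfl⟩ := m.even_or_odd'
  · rw [show (2 * k - 1) / 2 = 2 * k / 2 - 1 by omega, htop, parityConst, if_pos (by simp)]
    ring
  · rw [show (2 * k + 1 - 1) / 2 = (2 * k + 1) / 2 by omega, htop, parityConst,
      if_neg (by simp)]
    ring

/-- The subgroup `⟨a ^ m⟩` of the infinite cyclic group `⟨a⟩`. -/
abbrev cyclicMultiples (m : ℕ) : Subgroup (Multiplicative ℤ) :=
  (powMonoidHom m : Multiplicative ℤ →* Multiplicative ℤ).range

open Multiplicative

theorem mem_cyclicMultiples {m : ℕ} {x : Multiplicative ℤ} :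
    x ∈ cyclicMultiples m ↔ (m : ℤ) ∣ toAdd x := by
  constructor
  · rintro ⟨y, rfl⟩
    exact ⟨toAdd y, by simp⟩
  · rintro ⟨c, hc⟩
    exact ⟨ofAdd c, by apply toAdd.injective; simp [hc]⟩

theorem isComplement_balancedResidues (m : ℕ) [NeZero m] :
    Subgroup.IsComplement (cyclicMultiples m : Set (Multiplicative ℤ))
      (toAdd ⁻¹' balancedResidues m) := by
  rw [Subgroup.isComplement_iff_existsUnique_mul_inv_mem]
  intro g
  refine ⟨⟨ofAdd ((toAdd g).bmod m), ?_⟩, ?_, ?_⟩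
  · simp [mem_balancedResidues_iff]
  · refine mem_cyclicMultiples.2 ?_
    simpa [← sub_eq_add_neg] using Int.dvd_self_sub_bmod
  · rintro ⟨y, hy⟩ h
    rw [SetLike.mem_coe, mem_cyclicMultiples, toAdd_mul, toAdd_inv, ← sub_eq_add_neg,
      Int.dvd_iff_bmod_eq_zero, ← Int.bmod_eq_bmod_iff_bmod_sub_eq_zero] at h
    rw [Set.mem_preimage, SetLike.mem_coe, mem_balancedResidues_iff] at hy
    ext1
    apply toAdd.injective
    rw [toAdd_ofAdd, h, hy]

/-- The isomorphism `⟨a ^ p⟩ ≃* ⟨a ^ q⟩` sending `a ^ p` to `a ^ q`. -/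
noncomputable def cyclicMultiplesEquiv (p q : ℕ) [NeZero p] [NeZero q] :
    cyclicMultiples p ≃* cyclicMultiples q :=
  (MonoidHom.ofInjective (pow_left_injective (NeZero.ne p))).symm.trans
    (MonoidHom.ofInjective (pow_left_injective (NeZero.ne q)))

theorem cyclicMultiplesEquiv_pow (p q : ℕ) [NeZero p] [NeZero q] (x : Multiplicative ℤ) :
    (cyclicMultiplesEquiv p q ⟨x ^ p, x, rfl⟩ : Multiplicative ℤ) = x ^ q :=
  congrArg (fun y => ((MonoidHom.ofInjective (pow_left_injective (NeZero.ne q)) y :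
      cyclicMultiples q) : Multiplicative ℤ))
    (MulEquiv.symm_apply_apply (MonoidHom.ofInjective (pow_left_injective (NeZero.ne p))) x)

end Residues

section NormalForms

open HNNExtension HNNExtension.NormalWord Multiplicative

variable {p q : ℕ}

/-- The modulus of the exponent of `a` that follows `t ^ u` in a normal word. -/
def sideModulus (p q : ℕ) (u : ℤˣ) : ℕ := if u = 1 then p else q

instance [NeZero p] [NeZero q] (u : ℤˣ) : NeZero (sideModulus p q u) := by
  unfold sideModulus
  split_ifs <;> infer_instance

theorem toSubgroup_cyclicMultiples (u : ℤˣ) :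
    toSubgroup (cyclicMultiples p) (cyclicMultiples q) u =
      cyclicMultiples (sideModulus p q u) := by
  unfold toSubgroup sideModulus
  split_ifs <;> rfl

/-- The balanced residues as transversals for the HNN extension structure of `BS(p,q)`. -/
def balancedTransversal (p q : ℕ) [NeZero p] [NeZero q] :
    TransversalPair (Multiplicative ℤ) (cyclicMultiples p) (cyclicMultiples q) where
  set u := toAdd ⁻¹' balancedResidues (sideModulus p q u)
  compl u := by
    rw [toSubgroup_cyclicMultiples]
    exact isComplement_balancedResidues _

/-- The canonical homomorphism from `BS(p,q)` to the corresponding HNN extension of `ℤ`. -/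
noncomputable def BS.toHNN (p q : ℕ) [NeZero p] [NeZero q] :
    BS p q →* HNNExtension (Multiplicative ℤ) (cyclicMultiples p) (cyclicMultiples q)
      (cyclicMultiplesEquiv p q) :=
  PresentedGroup.toGroup
    (f := fun
      | BSGen.a => HNNExtension.of (ofAdd 1)
      | BSGen.t => HNNExtension.t) <| by
    rintro _ rfl
    have hconj := equiv_eq_conj (φ := cyclicMultiplesEquiv p q) ⟨_, ofAdd (1 : ℤ), rfl⟩
    simp only [powMonoidHom_apply, cyclicMultiplesEquiv_pow, map_pow] at hconj
    simp only [map_mul, map_pow, map_inv, FreeGroup.lift_apply_of, hconj, mul_inv_cancel]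

@[simp]
theorem BS.toHNN_a [NeZero p] [NeZero q] :
    BS.toHNN p q (PresentedGroup.of BSGen.a) = HNNExtension.of (ofAdd 1) :=
  PresentedGroup.toGroup.of _

@[simp]
theorem BS.toHNN_t [NeZero p] [NeZero q] :
    BS.toHNN p q (PresentedGroup.of BSGen.t) = HNNExtension.t :=
  PresentedGroup.toGroup.of _

/-- Letters coding normal words: `some ⟨u, r⟩` codes the syllable `t ^ u * a ^ r` with `r ≠ 0`, and
`none` codes a syllable `t ^ u` whose sign `u` is that of the next syllable. In this coding every
list of letters gives a normal word. -/
abbrev Syllable (p q : ℕ) : Type :=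
  Option (Σ u : ℤˣ, (balancedResidues (sideModulus p q u)).erase 0)

namespace Syllable

/-- The length of the word in `a` and `t` spelled by a syllable. -/
def length : Syllable p q → ℕ
  | none => 1
  | some s => 1 + s.2.1.natAbs

theorem length_pos (s : Syllable p q) : 0 < s.length := by
  cases s <;> simp [length]

/-- The pair `(u, a ^ r)` standing for the syllable `t ^ u * a ^ r` coded by a letter, where `v` is
the sign of the next syllable. -/
def expand (v : ℤˣ) : Syllable p q → ℤˣ × Multiplicative ℤ
  | none => (v, 1)
  | some s => (s.1, ofAdd s.2.1)

/-- The sign of the first syllable of a normal word, with the arbitrary value `1` for the empty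
word. -/
def leadingSign : List (ℤˣ × Multiplicative ℤ) → ℤˣ
  | [] => 1
  | x :: _ => x.1

/-- The list of syllables of the normal word with a given code. -/
def decode : List (Syllable p q) → List (ℤˣ × Multiplicative ℤ)
  | [] => []
  | s :: l => s.expand (leadingSign (decode l)) :: decode l

theorem expand_injective (v : ℤˣ) : Function.Injective (expand v : Syllable p q → _) := by
  rintro (_ | ⟨u, r, hr⟩) (_ | ⟨u', r', hr'⟩) h <;> simp only [expand, Prod.mk.injEq] at h
  · rfl
  · exact absurd (ofAdd_eq_one.1 h.2.symm) (Finset.ne_of_mem_erase hr')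
  · exact absurd (ofAdd_eq_one.1 h.2) (Finset.ne_of_mem_erase hr)
  · obtain ⟨rfl, h⟩ := h
    obtain rfl := ofAdd.injective h
    rfl

theorem decode_injective : Function.Injective (decode : List (Syllable p q) → _) := by
  intro l
  induction l with
  | nil => rintro (_ | ⟨s', l'⟩) h <;> simp_all [decode]
  | cons s l ih =>
    rintro (_ | ⟨s', l'⟩) h
    · simp [decode] at h
    · obtain ⟨hs, hl⟩ := List.cons.inj h
      obtain rfl := ih hl
      rw [expand_injective _ hs]

/-- The element of `BS(p,q)` represented by the normal word with a given code. -/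
def eval (l : List (Syllable p q)) : BS p q :=
  ((decode l).map fun x =>
    PresentedGroup.of BSGen.t ^ (x.1 : ℤ) * PresentedGroup.of BSGen.a ^ toAdd x.2).prod

theorem wordLength_eval_le (l : List (Syllable p q)) :
    wordLength (BS.gens p q) (eval l) ≤ (l.map length).sum := by
  have hsyllable (u : ℤˣ) (r : ℤ) : wordLength (BS.gens p q)
      (PresentedGroup.of BSGen.t ^ (u : ℤ) * PresentedGroup.of BSGen.a ^ r) ≤
        (1 + r.natAbs : ℕ) :=
    wordLength_mul_le (Int.units_natAbs u ▸ wordLength_zpow_le (.inr rfl) u)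
      (wordLength_zpow_le (.inl rfl) r)
  induction l with
  | nil => exact wordLength_one_le _
  | cons s l ih =>
    rw [List.map_cons, List.sum_cons]
    cases s <;> exact wordLength_mul_le (hsyllable _ _) ih

variable [NeZero p] [NeZero q]

theorem expand_fst_eq_of_mem_toSubgroup {v : ℤˣ} {s : Syllable p q}
    (h : (s.expand v).2 ∈ toSubgroup (cyclicMultiples p) (cyclicMultiples q) (s.expand v).1) :
    (s.expand v).1 = v := by
  rcases s with _ | ⟨u, r, hr⟩
  · rfl
  · rw [toSubgroup_cyclicMultiples, mem_cyclicMultiples, Int.dvd_iff_bmod_eq_zero] at h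
    obtain ⟨hr0, hr⟩ := Finset.mem_erase.1 hr
    exact absurd ((mem_balancedResidues_iff.1 hr).symm.trans h) hr0

theorem expand_snd_mem_balancedTransversal (v : ℤˣ) (s : Syllable p q) :
    (s.expand v).2 ∈ (balancedTransversal p q).set (s.expand v).1 := by
  rcases s with _ | ⟨u, r, hr⟩
  · exact mem_balancedResidues_iff.2 Int.zero_bmod
  · exact Finset.mem_of_mem_erase hr

theorem isChain_decode (l : List (Syllable p q)) :
    (decode l).IsChain fun x y =>
      x.2 ∈ toSubgroup (cyclicMultiples p) (cyclicMultiples q) x.1 → x.1 = y.1 := by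
  induction l with
  | nil => exact List.isChain_nil
  | cons s l ih =>
    refine List.isChain_cons.2 ⟨fun y hy hmem => ?_, ih⟩
    rw [expand_fst_eq_of_mem_toSubgroup hmem]
    obtain ⟨l', hl'⟩ := List.head?_eq_some_iff.1 hy
    rw [hl', leadingSign]

theorem mem_balancedTransversal_of_mem_decode (l : List (Syllable p q)) (u : ℤˣ)
    (g : Multiplicative ℤ) (h : (u, g) ∈ decode l) : g ∈ (balancedTransversal p q).set u := by
  induction l with
  | nil => simp [decode] at h
  | cons s l ih =>
    rcases List.mem_cons.1 h with h | h
    · have := expand_snd_mem_balancedTransversal (leadingSign (decode l)) s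
      rwa [← h] at this
    · exact ih h

/-- The normal word with a given code. -/
def normalWord (l : List (Syllable p q)) : NormalWord (balancedTransversal p q) where
  head := 1
  toList := decode l
  chain := isChain_decode l
  mem_set := mem_balancedTransversal_of_mem_decode l

theorem toHNN_eval (l : List (Syllable p q)) :
    BS.toHNN p q (eval l) = (normalWord l).prod (cyclicMultiplesEquiv p q) := by
  have hpow (x : Multiplicative ℤ) : (ofAdd (1 : ℤ)) ^ toAdd x = x := by
    rw [← ofAdd_zsmul]
    simp
  simp only [eval, map_list_prod, ReducedWord.prod, normalWord, List.map_map, map_one, one_mul,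
    Function.comp_def, map_mul, map_zpow, BS.toHNN_a, BS.toHNN_t, ← map_zpow of, hpow]

theorem eval_injective : Function.Injective (eval : List (Syllable p q) → BS p q) := by
  intro l l' h
  have hprod := congrArg (BS.toHNN p q) h
  rw [toHNN_eval, toHNN_eval] at hprod
  have hword := prod_injective (cyclicMultiplesEquiv p q) (balancedTransversal p q) hprod
  exact decode_injective (congrArg (fun w => w.toList) hword)

end Syllable

end NormalForms

section GrowthPolynomial

theorem exists_pos_sum_pow_eq_one {ι : Type*} [Fintype ι] [Nonempty ι] {len : ι → ℕ}
    (hlen : ∀ i, 0 < len i) : ∃ z : ℝ, 0 < z ∧ ∑ i, z ^ len i = 1 := by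
  have hzero : ∑ i, (0 : ℝ) ^ len i = 0 :=
    Finset.sum_eq_zero fun i _ => zero_pow (hlen i).ne'
  have hone : (1 : ℝ) ≤ ∑ i, (1 : ℝ) ^ len i := by
    simpa using Nat.one_le_iff_ne_zero.2 (Fintype.card_ne_zero (α := ι))
  obtain ⟨z, hz, hsum⟩ := intermediate_value_Icc zero_le_one
    (f := fun z : ℝ => ∑ i, z ^ len i) (by fun_prop) ⟨hzero.trans_le zero_le_one, hone⟩
  refine ⟨z, hz.1.lt_of_ne ?_, hsum⟩
  rintro rfl
  exact zero_ne_one (hzero.symm.trans hsum)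

theorem strictMonoOn_sum_pow {ι : Type*} [Fintype ι] [Nonempty ι] {len : ι → ℕ}
    (hlen : ∀ i, 0 < len i) : StrictMonoOn (fun z : ℝ => ∑ i, z ^ len i) (Set.Ici 0) :=
  fun _ hx _ _ hxy => Finset.sum_lt_sum_of_nonempty Finset.univ_nonempty fun i _ =>
    pow_lt_pow_left₀ hxy hx (hlen i).ne'

variable {p q : ℕ}

theorem Syllable.sum_pow_length (z : ℝ) :
    ∑ s : Syllable p q, z ^ s.length =
      z * (1 + ∑ r ∈ (balancedResidues p).erase 0, z ^ r.natAbs +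
        ∑ r ∈ (balancedResidues q).erase 0, z ^ r.natAbs) := by
  have hside (u : ℤˣ) : ∑ r : (balancedResidues (sideModulus p q u)).erase 0,
      z ^ length (some ⟨u, r⟩ : Syllable p q) =
        z * ∑ r ∈ (balancedResidues (sideModulus p q u)).erase 0, z ^ r.natAbs := by
    rw [Finset.mul_sum, ← Finset.sum_coe_sort _ fun r : ℤ => z * z ^ r.natAbs]
    simp only [length, pow_add, pow_one]
  have hne : (1 : ℤˣ) ≠ -1 := by decide
  rw [Fintype.sum_option, Fintype.sum_sigma]
  simp only [hside, UnitsInt.univ, Finset.sum_pair hne]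
  simp only [length, sideModulus, if_true, if_neg hne.symm]
  ring

theorem growthPoly_eq (hp : 2 ≤ p) (hpq : p ≤ q) :
    growthPoly p q = X ^ (q / 2 + 1) - X ^ (q / 2)
      - 2 * ∑ i ∈ Finset.Icc (q / 2 - p / 2 + 1) (q / 2 - 1), X ^ i
      - C (parityConst p) * X ^ (q / 2 - p / 2) - 2 * ∑ i ∈ Finset.Icc 1 (q / 2 - 1), X ^ i
      - C (parityConst q) := by
  have hC2 : (C (parityConst 2) : ℝ[X]) = 1 := by simp [parityConst]
  have hC3 : (C (parityConst 3) : ℝ[X]) = 2 := by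
    rw [parityConst, if_neg (by decide), map_ofNat]
  rw [growthPoly]
  split_ifs with h4 h3 hq3 hq2 hq3
  · rfl
  · subst h3 hq3
    norm_num [hC3]
    ring
  · subst h3
    simp [hC3]
  · obtain rfl : p = 2 := by omega
    subst hq2
    norm_num [hC2]
    ring
  · obtain rfl : p = 2 := by omega
    subst hq3
    norm_num [hC2, hC3]
    ring
  · obtain rfl : p = 2 := by omega
    simp [hC2]

theorem pow_mul_sum_inv_pow {K : Type*} [Field K] {x : K} (hx : x ≠ 0) {j l : ℕ} (hj : 1 ≤ j)
    (hjl : j ≤ l) :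
    x ^ l * ∑ i ∈ Finset.Icc 1 (j - 1), x⁻¹ ^ i =
      ∑ i ∈ Finset.Icc (l - j + 1) (l - 1), x ^ i := by
  rw [Finset.mul_sum]
  refine Finset.sum_nbij' (l - ·) (l - ·) ?_ ?_ ?_ ?_ fun i hi => ?_
  any_goals simp only [Finset.mem_Icc]; omega
  rw [Finset.mem_Icc] at hi
  rw [pow_sub₀ x hx (by omega), inv_pow]

theorem eval_growthPoly (hp : 2 ≤ p) (hpq : p ≤ q) {x : ℝ} (hx : x ≠ 0) :
    (growthPoly p q).eval x =
      x ^ (q / 2 + 1) * (1 - ∑ s : Syllable p q, x⁻¹ ^ s.length) := by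
  have hk : p / 2 ≤ q / 2 := Nat.div_le_div_right hpq
  have hsump := pow_mul_sum_inv_pow hx (j := p / 2) (l := q / 2) (by omega) hk
  have hsumq := pow_mul_sum_inv_pow hx (j := q / 2) (l := q / 2) (by omega) le_rfl
  have hpowp : x ^ (q / 2 - p / 2) = x ^ (q / 2) * x⁻¹ ^ (p / 2) := by
    rw [pow_sub₀ x hx hk, inv_pow]
  have hpowq : x ^ (q / 2) * x⁻¹ ^ (q / 2) = 1 := by
    rw [← mul_pow, mul_inv_cancel₀ hx, one_pow]
  have hsucc : x ^ (q / 2 + 1) * x⁻¹ = x ^ (q / 2) := by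
    rw [pow_succ, mul_assoc, mul_inv_cancel₀ hx, mul_one]
  rw [Nat.sub_self, zero_add] at hsumq
  rw [growthPoly_eq hp hpq, Syllable.sum_pow_length,
    sum_pow_natAbs_balancedResidues_erase_zero hp,
    sum_pow_natAbs_balancedResidues_erase_zero (hp.trans hpq), mul_sub, ← mul_assoc, hsucc]
  simp only [eval_sub, eval_mul, eval_pow, eval_X, eval_C, eval_ofNat, eval_finsetSum]
  rw [← hsump, ← hsumq, hpowp]
  linear_combination parityConst q * hpowq

theorem isRoot_growthPoly_iff (hp : 2 ≤ p) (hpq : p ≤ q) {x : ℝ} (hx : x ≠ 0) :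
    (growthPoly p q).IsRoot x ↔ ∑ s : Syllable p q, x⁻¹ ^ s.length = 1 := by
  rw [IsRoot, eval_growthPoly hp hpq hx, mul_eq_zero_iff_left (pow_ne_zero _ hx), sub_eq_zero,
    eq_comm]

theorem isGreatest_root_growthPoly (hp : 2 ≤ p) (hpq : p ≤ q) {z : ℝ} (hz : 0 < z)
    (hsum : ∑ s : Syllable p q, z ^ s.length = 1) :
    IsGreatest {x : ℝ | (growthPoly p q).IsRoot x} z⁻¹ := by
  refine ⟨(isRoot_growthPoly_iff hp hpq (inv_ne_zero hz.ne')).2 (by rwa [inv_inv]),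
    fun x hx => ?_⟩
  rcases le_or_gt x 0 with hx0 | hx0
  · exact hx0.trans (inv_pos.2 hz).le
  · have hxz : x⁻¹ = z := (strictMonoOn_sum_pow Syllable.length_pos).injOn (inv_pos.2 hx0).le hz.le
      (((isRoot_growthPoly_iff hp hpq hx0.ne').1 hx).trans hsum.symm)
    rw [← hxz, inv_inv]

end GrowthPolynomial

theorem theorem5p2 (p q : ℕ) (hp : 2 ≤ p) (hpq : p ≤ q) :
    Tendsto (fun n : ℕ => (growthFunction (BS.gens p q) n : ℝ) ^ (1 / (n : ℝ))) atTop
        (𝓝 (growthRate (BS.gens p q))) ∧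
      ∃ ρ : ℝ, IsGreatest {x : ℝ | (growthPoly p q).IsRoot x} ρ ∧
        ρ ≤ growthRate (BS.gens p q) := by
  have hfin : (BS.gens p q).Finite := (Set.finite_singleton _).insert _
  have : NeZero p := ⟨by omega⟩
  have : NeZero q := ⟨by omega⟩
  obtain ⟨z, hz, hsum⟩ := exists_pos_sum_pow_eq_one (Syllable.length_pos (p := p) (q := q))
  exact ⟨tendsto_growthRate hfin, z⁻¹, isGreatest_root_growthPoly hp hpq hz hsum,
    inv_le_growthRate_of_injective hfin Syllable.eval_injective Syllable.wordLength_eval_le hz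
      (hsum ▸ hasSum_fintype _)⟩
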